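/- **Setting.** Let $m\in\mathbb N$, let $\Omega\subset\mathbb C^m$ be a domain (open and connected, non-empty), and let $\mathscr U,\mathscr Y$ be complex Hilbert spaces; $B(\cdot,\cdot)$ denotes bounded linear operators. *Test functions.* A set $\Psi$ of functions $\psi:\Omega\to\mathbb C$ is a set of test functions if (1) $\sup_{\psi\in\Psi}|\psi(x)|<1$ for each $x\in\Omega$, and (2) for each finite $F\subset\Omega$ the restrictions $\psi|_F$, $\psi\in\Psi$, together with the constants generate the algebra of all functions $F\to\mathbb C$. *Admissible kernels.* For a Hilbert space $\mathcal E$, a function $k:\Omega\times\Omega\to B(\mathcal E)$ is a positive kernel if $\sum_{i,j=1}^n\langle k(z_i,z_j)e_j,e_i\rangle\ge 0$ for all $n\ge1$, $z_1,\dots,z_n\in\Omega$, $e_1,\dots,e_n\in\mathcal E$. Let $\mathcal H(k)$ be its reproducing kernel Hilbert space of $\mathcal E$-valued functions on $\Omega$. The kernel $k$ is $\Psi$-admissible if for every $\psi\in\Psi$ the map $h\mapsto\psi\cdot h$ is a contraction of $\mathcal H(k)$ into itself. Let $\mathcal K_\Psi(\mathcal E)$ be the set of $B(\mathcal E)$-valued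 $\Psi$-admissible kernels. *Schur–Agler class.* A function $S:\Omega\to B(\mathscr U,\mathscr Y)$ is in $H^\infty_\Psi(\mathscr U,\mathscr Y)$ if there is a constant $C\ge 0$ such that for every $k\in\mathcal K_\Psi(\mathscr Y)$ the function $(x,y)\mapsto (C^2I_{\mathscr Y}-S(x)S(y)^*)\otimes k(x,y)$ is a positive $B(\mathscr Y\otimes\mathscr Y)$-valued kernel (Hilbert space tensor product). Let $C_S$ be the smallest such $C$. The $\Psi$-Schur–Agler class $\mathscr{SA}_\Psi(\mathscr U,\mathscr Y)$ is the set of $S\in H^\infty_\Psi(\mathscr U,\mathscr Y)$ with $C_S\le 1$. **Theorem.** Suppose that $\Psi$ is a set of test functions on $\Omega$ and that every $\psi\in\Psi$ is holomorphic on $\Omega$. Then for each $z_0\in\Omega$ and each $S\in\mathscr{SA}_\Psi(\mathscr U,\mathscr Y)$ there are a multi-radius $\varepsilon\in(0,\infty)^m$ such that the polydisc $P(z_0,\varepsilon)=\{z:|z_i-z_{0,i}|<\varepsilon_i \text{ for all } i\}$ has compact closure contained in $\Omega$, and operators $a_\alpha\in B(\mathscr U,\mathscr Y)$, $\alpha\in\mathbb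 N^m$, with $\mathbb N=\{0,1,2,\dots\}$, such that $$S(z)=\sum_{\alpha\in\mathbb N^m}(z-z_0)^\alpha a_\alpha\qquad\text{for all } z\in P(z_0,\varepsilon),$$ where $(z-z_0)^\alpha=\prod_i (z_i-z_{0,i})^{\alpha_i}$. The series converges in operator norm, absolutely at each point of $P(z_0,\varepsilon)$ and uniformly on each compact subset of $P(z_0,\varepsilon)$. -/

import Mathlib

open scoped TensorProduct ComplexOrder

noncomputable section

namespace SchurAgler

/-- A set `Ψ` of complex functions on `X` is a set of test functions: at each point the values are
bounded by a constant smaller than one, uniformly over `Ψ`, and for each finite `F ⊆ X` the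
restrictions of `Ψ` to `F`, with the constants, generate the algebra of all functions on `F`. -/
structure IsTestFamily {X : Type*} (Ψ : Set (X → ℂ)) : Prop where
  sup_lt_one : ∀ x : X, ∃ r : ℝ, r < 1 ∧ ∀ ψ ∈ Ψ, ‖ψ x‖ ≤ r
  generates : ∀ F : Finset X,
    Algebra.adjoin ℂ ((fun ψ : X → ℂ => fun x : F => ψ x) '' Ψ) = (⊤ : Subalgebra ℂ (F → ℂ))

/-- Holomorphy of a function that is given only on the (open) subset `Ω` of `ℂ^m`. -/
def IsHolomorphic {m : ℕ} {Ω : Set (Fin m → ℂ)} (f : Ω → ℂ) : Prop :=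
  ∃ g : (Fin m → ℂ) → ℂ, DifferentiableOn ℂ g Ω ∧ ∀ z : Ω, g z = f z

section Kernels

variable {X E : Type*} [NormedAddCommGroup E] [InnerProductSpace ℂ E]

/-- Positive `B(E)`-valued kernels. The order on `ℂ` is the usual one: `0 ≤ c` says that `c` is
real and nonnegative. Inner products are linear in the second variable. -/
def IsPositiveKernel (k : X → X → E →L[ℂ] E) : Prop :=
  ∀ (n : ℕ) (z : Fin n → X) (e : Fin n → E),
    0 ≤ ∑ i, ∑ j, inner ℂ (e i) (k (z i) (z j) (e j))

variable [CompleteSpace E]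

theorem IsPositiveKernel.isHermitian {k : X → X → E →L[ℂ] E} (hk : IsPositiveKernel k) :
    (Matrix.of k).IsHermitian := by
  have h1 : ∀ (x : X) (a : E), (inner ℂ a (k x x a)).im = 0 := fun x a => by
    have := hk 1 (fun _ => x) (fun _ => a)
    simp only [Finset.univ_unique, Finset.sum_const, Finset.card_singleton, one_smul] at this
    exact (Complex.le_def.1 this).2.symm
  have h2 : ∀ (x y : X) (a b : E), (inner ℂ a (k x y b) + inner ℂ b (k y x a)).im = 0 := by
    intro x y a b
    have := (Complex.le_def.1 (hk 2 ![x, y] ![a, b])).2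
    simp only [Fin.sum_univ_two, Matrix.cons_val_zero, Matrix.cons_val_one, Complex.add_im,
      Complex.zero_im] at this
    have ha := h1 x a
    have hb := h1 y b
    simp only [Complex.add_im]
    linarith
  ext x y v
  refine ext_inner_left ℂ fun w => ?_
  have e1 := h2 x y w v
  have e2 := h2 x y w (Complex.I • v)
  simp only [map_smul, inner_smul_left, inner_smul_right, Complex.add_im, Complex.mul_im,
    Complex.I_re, Complex.I_im, Complex.conj_I, Complex.neg_re, Complex.neg_im] at e1 e2
  rw [Matrix.conjTranspose_apply]
  change inner ℂ w ((ContinuousLinearMap.adjoint (k y x)) v) = inner ℂ w (k x y v)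
  rw [ContinuousLinearMap.adjoint_inner_right, ← inner_conj_symm]
  apply Complex.ext
  · simp only [Complex.conj_re]; linarith
  · simp only [Complex.conj_im]; linarith

theorem IsPositiveKernel.posSemidef {k : X → X → E →L[ℂ] E} (hk : IsPositiveKernel k) :
    (Matrix.of k).PosSemidef := by
  have key := (RKHS.posSemidef_tfae (K := Matrix.of k)).out 0 2
  refine key.2 ⟨hk.isHermitian, fun v => ?_⟩
  have h := hk v.support.card (fun i => (v.support.equivFin.symm i : X))
    (fun i => v (v.support.equivFin.symm i : X))
  have h3 : ∑ i : v.support, ∑ j : v.support, (inner ℂ (v i) (k i j (v j))) =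
      ∑ i, ∑ j, inner ℂ (v (v.support.equivFin.symm i : X))
        (k (v.support.equivFin.symm i : X) (v.support.equivFin.symm j : X)
          (v (v.support.equivFin.symm j : X))) := by
    rw [← Equiv.sum_comp v.support.equivFin.symm]
    refine Finset.sum_congr rfl fun i _ => ?_
    rw [← Equiv.sum_comp v.support.equivFin.symm]
  rw [← h3] at h
  have h4 := (Complex.le_def.1 h).1
  refine h4.trans_eq ?_
  have h5 : (∑ i : v.support, ∑ j : v.support, (inner ℂ (v i) (k i j (v j)))) =
      ∑ i ∈ v.support, ∑ j ∈ v.support, inner ℂ (v i) (k i j (v j)) := by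
    rw [← Finset.sum_coe_sort v.support]
    refine Finset.sum_congr rfl fun i _ => ?_
    rw [← Finset.sum_coe_sort v.support]
  have h6 : (∑ i ∈ v.support, ∑ j ∈ v.support, inner ℂ (v i) (k i j (v j))) =
      starRingEnd ℂ (v.sum fun x w => v.sum fun x' w' => inner ℂ (Matrix.of k x' x w) w') := by
    simp only [Finsupp.sum, map_sum, inner_conj_symm, Matrix.of_apply]
    exact Finset.sum_comm
  rw [h5, h6]
  rfl

/-- The `Ψ`-admissible kernels: positive `B(E)`-valued kernels `k` such that multiplication by each
`ψ ∈ Ψ` maps the reproducing kernel Hilbert space `H(k)` (here Mathlib's `RKHS.OfKernel`) into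
itself contractively. -/
def IsAdmissible (Ψ : Set (X → ℂ)) (k : X → X → E →L[ℂ] E) : Prop :=
  ∃ hk : IsPositiveKernel k,
    haveI : Fact (Matrix.of k).PosSemidef := ⟨hk.posSemidef⟩
    ∀ ψ ∈ Ψ, ∀ h : RKHS.OfKernel (Matrix.of k),
      ∃ g : RKHS.OfKernel (Matrix.of k), (∀ x : X, g x = ψ x • h x) ∧ ‖g‖ ≤ ‖h‖

end Kernels

/-- The Hilbert space tensor product of `E` and `F`. -/
abbrev HilbertTensor (E F : Type*) [NormedAddCommGroup E] [InnerProductSpace ℂ E]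
    [NormedAddCommGroup F] [InnerProductSpace ℂ F] : Type _ :=
  UniformSpace.Completion (E ⊗[ℂ] F)

/-- The bounded operator `A ⊗ B` on the Hilbert space tensor product. -/
def opTensor {E F : Type*} [NormedAddCommGroup E] [InnerProductSpace ℂ E]
    [NormedAddCommGroup F] [InnerProductSpace ℂ F] (A : E →L[ℂ] E) (B : F →L[ℂ] F) :
    HilbertTensor E F →L[ℂ] HilbertTensor E F :=
  (TensorProduct.mapL A B).completion

section SchurAglerClass

variable {X U Y : Type*} [NormedAddCommGroup U] [InnerProductSpace ℂ U] [CompleteSpace U]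
  [NormedAddCommGroup Y] [InnerProductSpace ℂ Y] [CompleteSpace Y]

/-- The constants `C ≥ 0` for which `(C² I - S(x) S(y)^*) ⊗ k(x, y)` is a positive
`B(Y ⊗ Y)`-valued kernel for every `Ψ`-admissible `B(Y)`-valued kernel `k`. -/
def admissibleConstants (Ψ : Set (X → ℂ)) (S : X → U →L[ℂ] Y) : Set ℝ :=
  {C : ℝ | 0 ≤ C ∧ ∀ k : X → X → Y →L[ℂ] Y, IsAdmissible Ψ k →
    IsPositiveKernel fun x y =>
      opTensor ((C : ℂ) ^ 2 • ContinuousLinearMap.id ℂ Y - S x ∘L (S y).adjoint) (k x y)}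

/-- The space `H^∞_Ψ(U, Y)`. -/
def HInfty (Ψ : Set (X → ℂ)) : Set (X → U →L[ℂ] Y) :=
  {S | (admissibleConstants Ψ S).Nonempty}

/-- The smallest admissible constant `C_S` of `S ∈ H^∞_Ψ(U, Y)`. -/
def leastConstant (Ψ : Set (X → ℂ)) (S : X → U →L[ℂ] Y) : ℝ :=
  sInf (admissibleConstants Ψ S)

/-- The `Ψ`-Schur-Agler class: the functions `S ∈ H^∞_Ψ(U, Y)` with `C_S ≤ 1`. -/
def schurAglerClass (Ψ : Set (X → ℂ)) : Set (X → U →L[ℂ] Y) :=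
  {S | S ∈ HInfty Ψ ∧ leastConstant Ψ S ≤ 1}

end SchurAglerClass

/-- The open polydisc with centre `c` and multi-radius `r`. -/
def polydisc {m : ℕ} (c : Fin m → ℂ) (r : Fin m → ℝ) : Set (Fin m → ℂ) :=
  {z | ∀ i, ‖z i - c i‖ < r i}

/-- The monomial `w^α`. -/
def monomial {m : ℕ} (w : Fin m → ℂ) (α : Fin m → ℕ) : ℂ :=
  ∏ i, w i ^ α i

end SchurAgler

end

/-! Each test function is holomorphic and bounded by one on a closed polydisc about `z₀`, so it
multiplies the Hardy space of that polydisc contractively (`szegoKernel_contraction`). Hence the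
Szegő kernel `κ`, times a rank-one projection and extended by zero to `Ω`, is an admissible kernel
(`isAdmissible_polydiscKernel`). Testing an admissible constant `C` of `S` against it, on elementary
tensors, shows that `(C² - S(x) S(y)^*) κ(x, y)` is positive on the polydisc.

With `q x = (x - z₀) / r` and `k_x` the sequence `α ↦ conj (q x ^ α)`, this positivity is the
inequality `‖∑ k_x ⊗ S(x)^* v_x‖ ≤ C ‖∑ k_x ⊗ v_x‖` in `ℓ²`. By `exists_factor_of_norm_le` there is
`T : ℓ²(Y) → ℓ²(U)` with `‖T‖ ≤ C` and `T (k_x ⊗ y) = k_x ⊗ S(x)^* y`. The coordinate `α = 0` of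
this identity expands `S(x)^*` in powers of `conj (q x)`, with matrix entries of `T` as
coefficients; adjoints give the series of `S` (`exists_hasSum_of_szego_positive`). The coefficients
are bounded by `C`, so a geometric series dominates. -/

namespace SchurAgler

open MeasureTheory Set Complex ComplexConjugate

/-! ### Hardy space of the polydisc: geometric series, Cauchy's formula, Szegő kernel. -/

/-- Absolute convergence of the geometric series in several variables, with its sum. -/
theorem hasSum_monomial {m : ℕ} (q : Fin m → ℂ) (hq : ∀ i, ‖q i‖ < 1) :
    Summable (fun α : Fin m → ℕ => ‖monomial q α‖) ∧
      HasSum (fun α : Fin m → ℕ => monomial q α) (∏ i, (1 - q i)⁻¹) := by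
  induction m with
  | zero =>
    have h : (fun α : Fin 0 → ℕ => monomial q α) = fun _ => 1 := by
      funext α; simp [monomial]
    refine ⟨(hasSum_fintype _).summable, ?_⟩
    rw [h]
    simp
  | succ m ih =>
    obtain ⟨hs, ht⟩ := ih (fun i => q i.succ) fun i => hq i.succ
    have h0 := hasSum_geometric_of_norm_lt_one (hq 0)
    have hs0 : Summable fun k : ℕ => ‖q 0 ^ k‖ := by
      simpa using summable_geometric_of_lt_one (norm_nonneg _) (hq 0)
    have hcomp : (fun α : Fin (m + 1) → ℕ => monomial q α) ∘ Fin.consEquiv (fun _ => ℕ) =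
        fun p : ℕ × (Fin m → ℕ) => q 0 ^ p.1 * monomial (fun i => q i.succ) p.2 := by
      funext p
      simp [monomial, Fin.prod_univ_succ, Fin.consEquiv]
    have hsum : Summable fun p : ℕ × (Fin m → ℕ) =>
        ‖q 0 ^ p.1 * monomial (fun i => q i.succ) p.2‖ := hs0.mul_norm hs
    constructor
    · rw [← (Fin.consEquiv (fun _ => ℕ)).summable_iff]
      convert hsum using 1
      funext p
      exact congrArg norm (congrFun hcomp p)
    · rw [← (Fin.consEquiv (fun _ => ℕ)).hasSum_iff, hcomp, Fin.prod_univ_succ]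
      exact h0.mul ht hsum.of_norm

/-- Cauchy's integral formula on a polydisc with all radii equal. -/
theorem torusIntegral_cauchy {m : ℕ} {c x : Fin m → ℂ} {r : ℝ} (hx : ∀ i, ‖x i - c i‖ < r)
    {f : (Fin m → ℂ) → ℂ} (hf : ∀ z, (∀ i, ‖z i - c i‖ ≤ r) → DifferentiableAt ℂ f z) :
    (∯ ζ in T(c, fun _ => r), (∏ i, (ζ i - x i)⁻¹) * f ζ) = (2 * Real.pi * I) ^ m * f x := by
  induction m with
  | zero => simp [Subsingleton.elim c x]
  | succ m ih =>
    have hr : 0 < r := (norm_nonneg _).trans_lt (hx 0)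
    have hT : ∀ θ i, ‖torusMap c (fun _ => r) θ i - c i‖ = r := fun θ i => by
      simp [torusMap, Complex.norm_exp_ofReal_mul_I, abs_of_pos hr]
    have hne : ∀ θ i, torusMap c (fun _ => r) θ i - x i ≠ 0 := fun θ i h => by
      have h1 := hT θ i
      rw [sub_eq_zero.1 h] at h1
      exact (hx i).ne h1
    have hTc : Continuous (torusMap c fun _ => r) := by
      unfold torusMap; fun_prop
    have hint : TorusIntegrable (fun ζ => (∏ i, (ζ i - x i)⁻¹) * f ζ) c fun _ => r := by
      refine Continuous.integrableOn_Icc (Continuous.mul ?_ ?_)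
      · refine continuous_finsetProd _ fun i _ => Continuous.inv₀ ?_ fun θ => hne θ i
        exact ((continuous_apply i).comp hTc).sub continuous_const
      · refine continuous_iff_continuousAt.2 fun θ => ?_
        exact (hf _ fun i => (hT θ i).le).continuousAt.comp hTc.continuousAt
    rw [torusIntegral_succ hint]
    have hcons : ∀ w : ℂ, ‖w - c 0‖ ≤ r → ∀ z : Fin m → ℂ, (∀ i, ‖z i - c i.succ‖ ≤ r) →
        DifferentiableAt ℂ f (Fin.cons w z) := fun w hw z hz =>
      hf _ (Fin.cases (by simpa using hw) fun i => by simpa using hz i)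
    -- With the first coordinate frozen on its circle, the other coordinates fall under the
    -- induction hypothesis; one-variable Cauchy then handles `w`.
    have hinner : ∀ w ∈ Metric.sphere (c 0) r,
        (∯ y in T(c ∘ Fin.succ, (fun _ => r) ∘ Fin.succ),
          (∏ i, ((Fin.cons w y : Fin (m + 1) → ℂ) i - x i)⁻¹) * f (Fin.cons w y)) =
        (w - x 0)⁻¹ • ((2 * Real.pi * I) ^ m * f (Fin.cons w fun i => x i.succ)) := by
      intro w hw
      rw [mem_sphere_iff_norm] at hw
      have := ih (c := fun i => c i.succ) (x := fun i => x i.succ) (fun i => hx i.succ)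
        (f := fun z => f (Fin.cons w z)) fun z hz => by
          refine (hcons w hw.le z hz).comp z ?_
          refine differentiableAt_pi.2 (Fin.cases ?_ fun i => ?_)
          · simp
          · simpa using differentiableAt_apply i z
      rw [← this, smul_eq_mul, ← torusIntegral_const_mul]
      simp only [Fin.prod_univ_succ, Fin.cons_zero, Fin.cons_succ, mul_assoc]
      rfl
    rw [circleIntegral.integral_congr hr.le hinner]
    have hd : DifferentiableOn ℂ
        (fun w => (2 * Real.pi * I) ^ m * f (Fin.cons w fun i => x i.succ))
        (Metric.closedBall (c 0) r) := by
      intro w hw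
      rw [mem_closedBall_iff_norm] at hw
      refine DifferentiableAt.differentiableWithinAt (DifferentiableAt.const_mul ?_ _)
      refine (hcons w hw _ fun i => (hx i.succ).le).comp w ?_
      refine differentiableAt_pi.2 (Fin.cases ?_ fun i => ?_)
      · simp
      · simp
    rw [hd.circleIntegral_sub_inv_smul (mem_ball_iff_norm.2 (hx 0))]
    have : (Fin.cons (x 0) fun i => x i.succ : Fin (m + 1) → ℂ) = x := Fin.cons_self_tail x
    rw [this, smul_eq_mul]
    ring

/-- The Szegő kernel of the polydisc with centre `c` and all radii equal to `r`. -/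
noncomputable def szegoKernel {m : ℕ} (c : Fin m → ℂ) (r : ℝ) (x y : Fin m → ℂ) : ℂ :=
  ∏ i, (1 - (x i - c i) * conj (y i - c i) / (r : ℂ) ^ 2)⁻¹

theorem szegoKernel_conj {m : ℕ} (c : Fin m → ℂ) (r : ℝ) (x y : Fin m → ℂ) :
    conj (szegoKernel c r x y) = szegoKernel c r y x := by
  simp [szegoKernel, mul_comm]

/-- Since `y` is strictly inside, `|z i - c i| |y i - c i| < r²` even for `z` on the boundary. The
kernel functions are thus regular on the torus, where the Hardy space integrals live. -/
theorem differentiableAt_szegoKernel {m : ℕ} {c y : Fin m → ℂ} {r : ℝ}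
    (hy : ∀ i, ‖y i - c i‖ < r) {z : Fin m → ℂ} (hz : ∀ i, ‖z i - c i‖ ≤ r) :
    DifferentiableAt ℂ (fun z => szegoKernel c r z y) z := by
  unfold szegoKernel
  refine (HasFDerivAt.finsetProd fun i _ => DifferentiableAt.hasFDerivAt
    (f := fun z : Fin m → ℂ => (1 - (z i - c i) * conj (y i - c i) / (r : ℂ) ^ 2)⁻¹)
    (DifferentiableAt.fun_inv ?_ ?_)).differentiableAt
  · simp only [div_eq_mul_inv]
    exact (differentiableAt_const _).sub
      ((((differentiableAt_apply i z).sub (differentiableAt_const _)).mul_const _).mul_const _)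
  have hr : 0 < r := (norm_nonneg _).trans_lt (hy i)
  intro h
  have h1 : (z i - c i) * conj (y i - c i) = (r : ℂ) ^ 2 := by
    have := sub_eq_zero.1 h
    rw [eq_div_iff (by exact_mod_cast (pow_pos hr 2).ne')] at this
    rw [← this, one_mul]
  have h2 : ‖z i - c i‖ * ‖y i - c i‖ = r ^ 2 := by
    have := congrArg norm h1
    rwa [norm_mul, RCLike.norm_conj, norm_pow, norm_real, Real.norm_eq_abs, sq_abs] at this
  nlinarith [hz i, hy i, norm_nonneg (z i - c i), norm_nonneg (y i - c i)]

/-- The reproducing property of the Szegő kernel. -/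
theorem integral_szegoKernel_mul {m : ℕ} {c x : Fin m → ℂ} {r : ℝ} (hx : ∀ i, ‖x i - c i‖ < r)
    {f : (Fin m → ℂ) → ℂ} (hf : ∀ z, (∀ i, ‖z i - c i‖ ≤ r) → DifferentiableAt ℂ f z) :
    (∫ θ in Icc (0 : Fin m → ℝ) (fun _ => 2 * Real.pi),
      szegoKernel c r x (torusMap c (fun _ => r) θ) * f (torusMap c (fun _ => r) θ)) =
      (2 * Real.pi) ^ m * f x := by
  have h := torusIntegral_cauchy hx hf
  rw [torusIntegral, mul_pow, mul_right_comm] at h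
  rw [← mul_left_inj' (pow_ne_zero m I_ne_zero), ← h, ← integral_mul_const]
  congr 1
  funext θ
  -- On the torus `conj (ζ - c) = r² / (ζ - c)` in each coordinate, so a Szegő factor is the Cauchy
  -- factor times `ζ - c`. The Jacobian has an extra `I` per coordinate.
  have key : szegoKernel c r x (torusMap c (fun _ => r) θ) * I ^ m =
      (∏ i, (r : ℂ) * exp (θ i * I) * I) * ∏ i, (torusMap c (fun _ => r) θ i - x i)⁻¹ := by
    rw [szegoKernel, ← Fin.prod_const m I, ← Finset.prod_mul_distrib, ← Finset.prod_mul_distrib]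
    refine Finset.prod_congr rfl fun i _ => ?_
    have hr : 0 < r := (norm_nonneg _).trans_lt (hx i)
    have hr' : (r : ℂ) ≠ 0 := by exact_mod_cast hr.ne'
    set E := exp (θ i * I) with hE
    have hEc : conj E * E = 1 := by
      rw [mul_comm, mul_conj, normSq_eq_norm_sq, hE, norm_exp_ofReal_mul_I]; simp
    have hE0 : E ≠ 0 := exp_ne_zero _
    have hEc' : conj E = E⁻¹ := eq_inv_of_mul_eq_one_left hEc
    have hne : c i + r * E - x i ≠ 0 := by
      intro h0
      have h1 : x i - c i = r * E := by linear_combination -h0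
      have := hx i
      rw [h1, norm_mul, hE, norm_exp_ofReal_mul_I, norm_real, Real.norm_eq_abs,
        abs_of_pos hr, mul_one] at this
      exact lt_irrefl _ this
    have e1 : 1 - (x i - c i) * conj (torusMap c (fun _ => r) θ i - c i) / (r : ℂ) ^ 2 =
        (c i + r * E - x i) / (r * E) := by
      simp only [torusMap, ← hE, add_sub_cancel_left, map_mul, conj_ofReal, hEc']
      field_simp
      ring
    rw [e1, inv_div]
    simp only [torusMap, ← hE]
    ring
  rw [smul_eq_mul, ← mul_assoc, ← key]
  ring

/-- Multiplication by a holomorphic function bounded by one is a contraction of the Hardy space of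
the polydisc. -/
theorem szegoKernel_contraction {m : ℕ} {c : Fin m → ℂ} {r : ℝ} (hr : 0 < r)
    {ψ : (Fin m → ℂ) → ℂ} (hd : ∀ z, (∀ i, ‖z i - c i‖ ≤ r) → DifferentiableAt ℂ ψ z)
    (hb : ∀ z, (∀ i, ‖z i - c i‖ ≤ r) → ‖ψ z‖ ≤ 1) {ι : Type*} [Fintype ι]
    (x : ι → Fin m → ℂ) (hx : ∀ j i, ‖x j i - c i‖ < r) (v : ι → ℂ) :
    0 ≤ ∑ j, ∑ k, conj (v j) * v k *
      ((1 - ψ (x j) * conj (ψ (x k))) * szegoKernel c r (x j) (x k)) := by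
  set T := torusMap c (fun _ => r)
  have hT : ∀ θ i, ‖T θ i - c i‖ ≤ r := fun θ i => by
    simp [T, torusMap, Complex.norm_exp_ofReal_mul_I, abs_of_pos hr]
  have hTc : Continuous T := by
    unfold T torusMap; fun_prop
  set Q := Icc (0 : Fin m → ℝ) (fun _ => 2 * Real.pi)
  have hcont : ∀ f : (Fin m → ℂ) → ℂ,
      (∀ z, (∀ i, ‖z i - c i‖ ≤ r) → DifferentiableAt ℂ f z) → Continuous fun θ => f (T θ) :=
    fun f hf => continuous_iff_continuousAt.2 fun θ =>
      (hf _ (hT θ)).continuousAt.comp hTc.continuousAt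
  have hspan : ∀ w : ι → ℂ, ∀ z, (∀ i, ‖z i - c i‖ ≤ r) →
      DifferentiableAt ℂ (fun z => ∑ k, w k * szegoKernel c r z (x k)) z := fun w z hz =>
    DifferentiableAt.fun_sum fun k _ => (differentiableAt_szegoKernel (hx k) hz).const_mul _
  have hrepr : ∀ w : ι → ℂ, ∀ f : (Fin m → ℂ) → ℂ,
      (∀ z, (∀ i, ‖z i - c i‖ ≤ r) → DifferentiableAt ℂ f z) →
      (∫ θ in Q, conj (∑ k, w k * szegoKernel c r (T θ) (x k)) * f (T θ)) =
        (2 * Real.pi) ^ m * ∑ k, conj (w k) * f (x k) := by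
    intro w f hf
    have e : ∀ θ, conj (∑ k, w k * szegoKernel c r (T θ) (x k)) * f (T θ) =
        ∑ k, conj (w k) * (szegoKernel c r (x k) (T θ) * f (T θ)) := fun θ => by
      rw [map_sum, Finset.sum_mul]
      refine Finset.sum_congr rfl fun k _ => ?_
      rw [map_mul, szegoKernel_conj, mul_assoc]
    simp only [e]
    rw [integral_finsetSum, Finset.mul_sum]
    · refine Finset.sum_congr rfl fun k _ => ?_
      rw [integral_const_mul, integral_szegoKernel_mul (hx k) hf]
      ring
    · intro k _
      refine Continuous.integrableOn_Icc (continuous_const.mul (Continuous.mul ?_ (hcont f hf)))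
      have := (continuous_conj.comp
        (hcont _ fun z hz => differentiableAt_szegoKernel (hx k) hz))
      simpa only [Function.comp_def, szegoKernel_conj] using this
  set h : (Fin m → ℂ) → ℂ := fun z => ∑ k, v k * szegoKernel c r z (x k) with hh
  -- `g` is the adjoint of multiplication by `ψ`, applied to `h`. The claim is `‖g‖² ≤ ‖h‖²` in the
  -- Hardy space.
  set g : (Fin m → ℂ) → ℂ := fun z => ∑ k, v k * conj (ψ (x k)) * szegoKernel c r z (x k) with hg
  have hhd := hspan v
  have hgd := hspan fun k => v k * conj (ψ (x k))
  have i1 := hrepr v h hhd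
  have i2 := hrepr (fun k => v k * conj (ψ (x k))) g hgd
  have i3 := hrepr v (fun z => ψ z * g z) fun z hz => (hd z hz).mul (hgd z hz)
  have ch := hcont h hhd
  have cg := hcont g hgd
  have cψ := hcont ψ hd
  have i23 : (∫ θ in Q, conj (h (T θ)) * (ψ (T θ) * g (T θ))) =
      ∫ θ in Q, conj (g (T θ)) * g (T θ) := by
    refine i3.trans (Eq.trans ?_ i2.symm)
    congr 1
    refine Finset.sum_congr rfl fun k _ => ?_
    simp [mul_assoc]
  have i4 : (∫ θ in Q, conj (conj (h (T θ)) * (ψ (T θ) * g (T θ)))) =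
      ∫ θ in Q, conj (g (T θ)) * g (T θ) := by
    rw [integral_conj, i23, ← integral_conj]
    simp only [map_mul, conj_conj, mul_comm]
  -- Since `⟨h, ψ g⟩ = ‖g‖²`, this integral equals `‖h‖² - ‖g‖²`.
  have hpos : 0 ≤ ∫ θ in Q, (((‖h (T θ) - ψ (T θ) * g (T θ)‖ ^ 2 +
      (1 - ‖ψ (T θ)‖ ^ 2) * ‖g (T θ)‖ ^ 2 : ℝ)) : ℂ) := by
    refine le_of_le_of_eq ?_ (integral_ofReal (𝕜 := ℂ)).symm
    refine zero_le_real.2 (integral_nonneg fun θ => ?_)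
    have := hb _ (hT θ)
    have h1 : 0 ≤ 1 - ‖ψ (T θ)‖ ^ 2 := by nlinarith [norm_nonneg (ψ (T θ))]
    exact add_nonneg (sq_nonneg _) (mul_nonneg h1 (sq_nonneg _))
  have hpt : ∀ θ, (((‖h (T θ) - ψ (T θ) * g (T θ)‖ ^ 2 +
      (1 - ‖ψ (T θ)‖ ^ 2) * ‖g (T θ)‖ ^ 2 : ℝ)) : ℂ) =
      (conj (h (T θ)) * h (T θ) + conj (g (T θ)) * g (T θ) -
        conj (h (T θ)) * (ψ (T θ) * g (T θ))) -
        conj (conj (h (T θ)) * (ψ (T θ) * g (T θ))) := fun θ => by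
    push_cast
    simp only [← conj_mul', map_sub, map_mul, conj_conj]
    ring
  simp only [hpt] at hpos
  have I1 : Integrable (fun θ => conj (h (T θ)) * h (T θ)) (volume.restrict Q) :=
    Continuous.integrableOn_Icc ((continuous_conj.comp ch).mul ch)
  have I2 : Integrable (fun θ => conj (g (T θ)) * g (T θ)) (volume.restrict Q) :=
    Continuous.integrableOn_Icc ((continuous_conj.comp cg).mul cg)
  have I3 : Integrable (fun θ => conj (h (T θ)) * (ψ (T θ) * g (T θ))) (volume.restrict Q) :=
    Continuous.integrableOn_Icc ((continuous_conj.comp ch).mul (cψ.mul cg))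
  have I4 : Integrable (fun θ => conj (conj (h (T θ)) * (ψ (T θ) * g (T θ))))
      (volume.restrict Q) := Continuous.integrableOn_Icc 
      (continuous_conj.comp ((continuous_conj.comp ch).mul (cψ.mul cg)))
  have I5 : Integrable (fun θ => conj (h (T θ)) * h (T θ) + conj (g (T θ)) * g (T θ))
      (volume.restrict Q) := I1.add I2
  have I6 : Integrable (fun θ => conj (h (T θ)) * h (T θ) + conj (g (T θ)) * g (T θ) -
      conj (h (T θ)) * (ψ (T θ) * g (T θ))) (volume.restrict Q) := I5.sub I3
  rw [integral_sub I6 I4, integral_sub I5 I3, integral_add I1 I2,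
    i4, i23, add_sub_cancel_right] at hpos
  have hpi : (2 * Real.pi : ℂ) ^ m ≠ 0 := by
    exact_mod_cast (pow_pos Real.two_pi_pos m).ne'
  have hpi' : (0 : ℂ) ≤ ((((2 * Real.pi) ^ m)⁻¹ : ℝ) : ℂ) :=
    zero_le_real.2 (inv_nonneg.2 (pow_pos Real.two_pi_pos m).le)
  refine (mul_nonneg hpi' hpos).trans_eq ?_
  push_cast
  rw [inv_mul_eq_iff_eq_mul₀ hpi]
  rw [i1, i2, ← mul_sub, ← Finset.sum_sub_distrib]
  congr 1
  refine Finset.sum_congr rfl fun j _ => ?_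
  simp only [hh, hg, Finset.mul_sum]
  rw [← Finset.sum_sub_distrib]
  refine Finset.sum_congr rfl fun k _ => ?_
  simp only [map_mul, conj_conj]
  ring

/-- The expansion of the Szegő kernel into monomials. -/
theorem hasSum_szegoKernel {m : ℕ} {c x y : Fin m → ℂ} {r : ℝ}
    (hx : ∀ i, ‖x i - c i‖ < r) (hy : ∀ i, ‖y i - c i‖ < r) :
    HasSum (fun α : Fin m → ℕ => monomial (fun i => (x i - c i) / r) α *
      conj (monomial (fun i => (y i - c i) / r) α)) (szegoKernel c r x y) := by
  have h := (hasSum_monomial (fun i => (x i - c i) * conj (y i - c i) / (r : ℂ) ^ 2) ?_).2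
  · rw [szegoKernel]
    convert h using 2 with α
    simp only [monomial, map_prod, ← Finset.prod_mul_distrib]
    refine Finset.prod_congr rfl fun i _ => ?_
    rw [map_pow, ← mul_pow, map_div₀, conj_ofReal, div_mul_div_comm, sq]
  · intro i
    have hr : 0 < r := (norm_nonneg _).trans_lt (hx i)
    rw [norm_div, norm_mul, RCLike.norm_conj, norm_pow, norm_real, Real.norm_eq_abs, sq_abs,
      div_lt_one (by positivity)]
    nlinarith [hx i, hy i, norm_nonneg (x i - c i), norm_nonneg (y i - c i)]

end SchurAgler

/-! ### Factorization of operators and a criterion for admissibility. -/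

namespace SchurAgler

open ComplexConjugate

/-- If `‖B v‖ ≤ C ‖A v‖` for all `v`, then `B` factors through `A` by an operator of norm at
most `C`. -/
theorem exists_factor_of_norm_le {V H G : Type*} [AddCommGroup V] [Module ℂ V]
    [NormedAddCommGroup H] [InnerProductSpace ℂ H] [CompleteSpace H]
    [NormedAddCommGroup G] [InnerProductSpace ℂ G] [CompleteSpace G]
    (A : V →ₗ[ℂ] H) (B : V →ₗ[ℂ] G) {C : ℝ} (hC : 0 ≤ C) (h : ∀ v, ‖B v‖ ≤ C * ‖A v‖) :
    ∃ T : H →L[ℂ] G, ‖T‖ ≤ C ∧ ∀ v, T (A v) = B v := by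
  set M := (LinearMap.range A).topologicalClosure
  have hM : ∀ v, A v ∈ M := fun v => Submodule.le_topologicalClosure _ ⟨v, rfl⟩
  let A' : V →ₗ[ℂ] M := A.codRestrict M hM
  have hdense : DenseRange A' := by
    intro x
    rw [Metric.mem_closure_iff]
    intro ε hε
    obtain ⟨_, ⟨v, rfl⟩, hv⟩ := Metric.mem_closure_iff.1 x.2 ε hε
    exact ⟨A' v, ⟨v, rfl⟩, hv⟩
  have hnorm : ∀ v, ‖B v‖ ≤ C * ‖A' v‖ := h
  have : CompleteSpace M := (Submodule.isClosed_topologicalClosure _).completeSpace_coe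
  refine ⟨(B.extendOfNorm A').comp M.orthogonalProjectionOnto, ?_, fun v => ?_⟩
  · refine ContinuousLinearMap.opNorm_le_bound _ hC fun x => ?_
    refine (LinearMap.norm_extendOfNorm_apply_le hdense C hnorm _).trans ?_
    exact mul_le_mul_of_nonneg_left (M.norm_orthogonalProjectionOnto_apply_le x) hC
  · rw [ContinuousLinearMap.comp_apply]
    have : M.orthogonalProjectionOnto (A v) = A' v :=
      Submodule.orthogonalProjectionOnto_mem_subspace_eq_self (A' v)
    rw [this, LinearMap.extendOfNorm_eq hdense ⟨C, hnorm⟩]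

section

variable {X E : Type*} [NormedAddCommGroup E] [InnerProductSpace ℂ E]

theorem IsPositiveKernel.sum_nonneg {k : X → X → E →L[ℂ] E} (hk : IsPositiveKernel k)
    {ι : Type*} (p : ι → X) (s : Finset ι) (e : ι → E) :
    0 ≤ ∑ i ∈ s, ∑ j ∈ s, inner ℂ (e i) (k (p i) (p j) (e j)) := by
  have h := hk s.card (fun i => p (s.equivFin.symm i)) (fun i => e (s.equivFin.symm i))
  refine h.trans_eq ?_
  rw [← Finset.sum_coe_sort s, ← Equiv.sum_comp s.equivFin.symm]
  refine Finset.sum_congr rfl fun i _ => ?_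
  rw [← Finset.sum_coe_sort s, ← Equiv.sum_comp s.equivFin.symm]

variable [CompleteSpace E]

/-- A kernel `k` is admissible as soon as all `(1 - ψ(x) ψ(y)^*) k(x, y)` are positive. -/
theorem isAdmissible_of_isPositiveKernel {Ψ : Set (X → ℂ)} {k : X → X → E →L[ℂ] E}
    (hk : IsPositiveKernel k)
    (h : ∀ ψ ∈ Ψ, IsPositiveKernel fun x y => (1 - ψ x * conj (ψ y)) • k x y) :
    IsAdmissible Ψ k := by
  refine ⟨hk, ?_⟩
  have : Fact (Matrix.of k).PosSemidef := ⟨hk.posSemidef⟩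
  intro ψ hψ f
  let H := RKHS.OfKernel (Matrix.of k)
  let A : (X →₀ E) →ₗ[ℂ] H := Finsupp.lsum ℂ fun x => (RKHS.kerFun H x).toLinearMap
  let B : (X →₀ E) →ₗ[ℂ] H :=
    Finsupp.lsum ℂ fun x => conj (ψ x) • (RKHS.kerFun H x).toLinearMap
  have hin : ∀ x y (v w : E),
      inner ℂ (RKHS.kerFun H x v) (RKHS.kerFun H y w) = inner ℂ v (k x y w) := fun x y v w => by
    rw [RKHS.kerFun_inner, RKHS.kerFun_apply, RKHS.OfKernel.kernel_ofKernel]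
    rfl
  have hA : ∀ v : X →₀ E, A v = ∑ x ∈ v.support, RKHS.kerFun H x (v x) := fun v => rfl
  have hB : ∀ v : X →₀ E, B v = ∑ x ∈ v.support, conj (ψ x) • RKHS.kerFun H x (v x) :=
    fun v => rfl
  have hBA : ∀ v, ‖B v‖ ≤ 1 * ‖A v‖ := by
    intro v
    rw [one_mul, ← sq_le_sq₀ (norm_nonneg _) (norm_nonneg _), ← sub_nonneg]
    have h1 := (h ψ hψ).sum_nonneg id v.support v
    have h2 : ∑ x ∈ v.support, ∑ y ∈ v.support,
        inner ℂ (v x) (((1 - ψ x * conj (ψ y)) • k x y) (v y)) =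
        inner ℂ (A v) (A v) - inner ℂ (B v) (B v) := by
      rw [hA, hB, sum_inner, sum_inner, ← Finset.sum_sub_distrib]
      refine Finset.sum_congr rfl fun x _ => ?_
      rw [inner_sum, inner_sum, ← Finset.sum_sub_distrib]
      refine Finset.sum_congr rfl fun y _ => ?_
      rw [inner_smul_left, inner_smul_right, hin, smul_apply,
        inner_smul_right, Complex.conj_conj]
      ring
    rw [inner_self_eq_norm_sq_to_K, inner_self_eq_norm_sq_to_K] at h2
    replace h1 := h1.trans_eq h2
    refine Complex.zero_le_real.1 (h1.trans_eq ?_)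
    push_cast
    rfl
  -- `T` multiplies the kernel function at `x` by `conj (ψ x)`; by the reproducing property its
  -- adjoint is multiplication by `ψ`.
  obtain ⟨T, hT, hTA⟩ := exists_factor_of_norm_le A B zero_le_one hBA
  refine ⟨T.adjoint f, fun x => ext_inner_left ℂ fun v => ?_, ?_⟩
  · have e1 : A (Finsupp.single x v) = RKHS.kerFun H x v := by simp [A]
    have e2 : B (Finsupp.single x v) = conj (ψ x) • RKHS.kerFun H x v := by simp [B]
    rw [← RKHS.kerFun_inner, ContinuousLinearMap.adjoint_inner_right, ← e1, hTA, e2,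
      inner_smul_left, Complex.conj_conj, RKHS.kerFun_inner, inner_smul_right]
  · refine (T.adjoint.le_opNorm f).trans ?_
    rw [LinearIsometryEquiv.norm_map]
    exact mul_le_of_le_one_left (norm_nonneg _) hT

end

end SchurAgler

/-! ### Power series from positivity against the Szegő kernel. -/

namespace SchurAgler

open ComplexConjugate
open scoped ENNReal

section

variable {m : ℕ} {E : Type*} [NormedAddCommGroup E] [InnerProductSpace ℂ E]

/-- The square summable family `α ↦ conj (q ^ α) • v`. -/
noncomputable def monomialVector (q : Fin m → ℂ) (hq : ∀ i, ‖q i‖ < 1) :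
    E →ₗ[ℂ] lp (fun _ : Fin m → ℕ => E) 2 where
  toFun v := ⟨fun α => conj (monomial q α) • v, by
    have h1 : Memℓp (fun α : Fin m → ℕ => conj (monomial q α) • v) 1 := by
      refine memℓp_gen ?_
      simpa [norm_smul] using (hasSum_monomial q hq).1.mul_right ‖v‖
    exact h1.of_exponent_ge one_le_two⟩
  map_add' v w := by ext α; exact smul_add _ _ _
  map_smul' a v := by ext α; exact smul_comm _ _ _

@[simp]
theorem monomialVector_apply (q : Fin m → ℂ) (hq : ∀ i, ‖q i‖ < 1) (v : E) (α : Fin m → ℕ) :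
    (monomialVector q hq v : (Fin m → ℕ) → E) α = conj (monomial q α) • v := rfl

/-- These vectors are the Hardy space kernel functions, tensored with `E` and written in
coefficients; Gram matrices over them are kernel sums. -/
theorem inner_monomialVector {p q : Fin m → ℂ} (hp : ∀ i, ‖p i‖ < 1) (hq : ∀ i, ‖q i‖ < 1)
    {κ : ℂ} (hκ : HasSum (fun α : Fin m → ℕ => monomial p α * conj (monomial q α)) κ) (v w : E) :
    inner ℂ (monomialVector p hp v) (monomialVector q hq w) = inner ℂ v w * κ := by
  have h := lp.hasSum_inner (𝕜 := ℂ) (monomialVector p hp v) (monomialVector q hq w)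
  have e : (fun α => inner ℂ ((monomialVector p hp v : (Fin m → ℕ) → E) α)
      ((monomialVector q hq w : (Fin m → ℕ) → E) α)) =
      fun α => inner ℂ v w * (monomial p α * conj (monomial q α)) := funext fun α => by
    rw [monomialVector_apply, monomialVector_apply, inner_smul_left, inner_smul_right,
      Complex.conj_conj]
    ring
  rw [e] at h
  exact h.unique (hκ.mul_left _)

end

section

variable {U Y : Type*} [NormedAddCommGroup U] [InnerProductSpace ℂ U] [CompleteSpace U]
  [NormedAddCommGroup Y] [InnerProductSpace ℂ Y] [CompleteSpace Y]

/-- If `(C² - S(x) S(y)^*) κ(x, y)` is positive, where `κ` is the Szegő kernel in the coordinates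
`q`, then `S` is a power series in `q` with bounded coefficients. -/
theorem exists_hasSum_of_szego_positive {X : Type*} {m : ℕ} (q : X → Fin m → ℂ)
    (hq : ∀ x i, ‖q x i‖ < 1) (κ : X → X → ℂ)
    (hκ : ∀ x y, HasSum (fun α => monomial (q x) α * conj (monomial (q y) α)) (κ x y))
    (S : X → U →L[ℂ] Y) {C : ℝ} (hC : 0 ≤ C)
    (hpos : ∀ (s : Finset X) (v : X → Y), 0 ≤ ∑ x ∈ s, ∑ y ∈ s,
      inner ℂ (v x) (((C : ℂ) ^ 2 • ContinuousLinearMap.id ℂ Y - S x ∘L (S y).adjoint) (v y)) *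
        κ x y) :
    ∃ b : (Fin m → ℕ) → U →L[ℂ] Y, (∀ α, ‖b α‖ ≤ C) ∧
      ∀ x, HasSum (fun α => monomial (q x) α • b α) (S x) := by
  classical
  let A : (X →₀ Y) →ₗ[ℂ] lp (fun _ : Fin m → ℕ => Y) 2 :=
    Finsupp.lsum ℂ fun x => monomialVector (q x) (hq x)
  let B : (X →₀ Y) →ₗ[ℂ] lp (fun _ : Fin m → ℕ => U) 2 :=
    Finsupp.lsum ℂ fun x => monomialVector (q x) (hq x) ∘ₗ ((S x).adjoint : Y →ₗ[ℂ] U)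
  have hA : ∀ v : X →₀ Y, A v = ∑ x ∈ v.support, monomialVector (q x) (hq x) (v x) :=
    fun v => rfl
  have hB : ∀ v : X →₀ Y,
      B v = ∑ x ∈ v.support, monomialVector (q x) (hq x) ((S x).adjoint (v x)) := fun v => rfl
  have hBA : ∀ v, ‖B v‖ ≤ C * ‖A v‖ := by
    intro v
    rw [← sq_le_sq₀ (norm_nonneg _) (by positivity), ← sub_nonneg, mul_pow]
    have h2 : ∑ x ∈ v.support, ∑ y ∈ v.support,
        inner ℂ (v x) (((C : ℂ) ^ 2 • ContinuousLinearMap.id ℂ Y - S x ∘L (S y).adjoint) (v y)) *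
          κ x y = (C : ℂ) ^ 2 * inner ℂ (A v) (A v) - inner ℂ (B v) (B v) := by
      rw [hA, hB, sum_inner, sum_inner, Finset.mul_sum, ← Finset.sum_sub_distrib]
      refine Finset.sum_congr rfl fun x _ => ?_
      rw [inner_sum, inner_sum, Finset.mul_sum, ← Finset.sum_sub_distrib]
      refine Finset.sum_congr rfl fun y _ => ?_
      rw [inner_monomialVector _ _ (hκ x y), inner_monomialVector _ _ (hκ x y),
        ContinuousLinearMap.adjoint_inner_left]
      simp only [sub_apply, smul_apply, ContinuousLinearMap.coe_id', id_eq,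
        ContinuousLinearMap.comp_apply, inner_sub_right, inner_smul_right]
      ring
    have h1 := hpos v.support v
    rw [inner_self_eq_norm_sq_to_K, inner_self_eq_norm_sq_to_K] at h2
    replace h1 := h1.trans_eq h2
    refine Complex.zero_le_real.1 (h1.trans_eq ?_)
    push_cast
    rfl
  obtain ⟨T, hT, hTA⟩ := exists_factor_of_norm_le A B hC hBA
  -- Row `0` of the matrix of `T`: as `q ^ 0 = 1`, coordinate `0` of `k_x ⊗ S(x)^* y` is `S(x)^* y`
  -- itself.
  let D : (Fin m → ℕ) → Y →L[ℂ] U := fun α =>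
    lp.evalCLM ℂ (fun _ : Fin m → ℕ => U) 2 (0 : Fin m → ℕ) ∘L T ∘L
      lp.singleContinuousLinearMap ℂ (fun _ : Fin m → ℕ => Y) 2 α
  have hDapply : ∀ α y, D α y =
      (T (lp.single 2 α y) : (Fin m → ℕ) → U) 0 := fun α y => rfl
  have hD : ∀ α, ‖D α‖ ≤ C := fun α => by
    refine ContinuousLinearMap.opNorm_le_bound _ hC fun y => ?_
    rw [hDapply]
    refine (lp.norm_apply_le_norm two_ne_zero _ _).trans ((T.le_opNorm _).trans ?_)
    rw [lp.norm_single (by norm_num)]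
    exact mul_le_mul_of_nonneg_right hT (norm_nonneg _)
  refine ⟨fun α => (D α).adjoint, fun α => by rw [LinearIsometryEquiv.norm_map]; exact hD α,
    fun x => ?_⟩
  have hsum : Summable fun α => conj (monomial (q x) α) • D α := by
    refine Summable.of_norm_bounded ((hasSum_monomial (q x) (hq x)).1.mul_right C) fun α => ?_
    rw [norm_smul, RCLike.norm_conj]
    exact mul_le_mul_of_nonneg_left (hD α) (norm_nonneg _)
  have hval : ∑' α, conj (monomial (q x) α) • D α = (S x).adjoint := by
    ext y
    have e1 := hsum.hasSum.mapL (ContinuousLinearMap.apply ℂ U y)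
    have e2 := (lp.hasSum_single (by norm_num) (monomialVector (q x) (hq x) y)).mapL
      (lp.evalCLM ℂ (fun _ : Fin m → ℕ => U) 2 (0 : Fin m → ℕ) ∘L T)
    have e3 : T (monomialVector (q x) (hq x) y) =
        monomialVector (q x) (hq x) ((S x).adjoint y) := by
      have := hTA (Finsupp.single x y)
      simpa [A, B] using this
    have e4 : (lp.evalCLM ℂ (fun _ : Fin m → ℕ => U) 2 (0 : Fin m → ℕ) ∘L T) (monomialVector (q x) (hq x) y) =
        (S x).adjoint y := by
      change (T (monomialVector (q x) (hq x) y) : (Fin m → ℕ) → U) 0 = _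
      rw [e3, monomialVector_apply]
      simp [monomial]
    rw [e4] at e2
    refine e1.unique ?_
    convert e2 using 2 with α
    change conj (monomial (q x) α) • D α y = D α (conj (monomial (q x) α) • y)
    rw [map_smul]
  have h := hsum.hasSum
  rw [hval] at h
  -- The adjoint is norm continuous, so convergence in operator norm survives.
  have h' := h.map (ContinuousLinearMap.adjoint (𝕜 := ℂ) (E := Y) (F := U))
    (ContinuousLinearMap.adjoint (𝕜 := ℂ) (E := Y) (F := U)).continuous
  rw [ContinuousLinearMap.adjoint_adjoint] at h'
  have e : (fun α => monomial (q x) α • (D α).adjoint) =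
      ContinuousLinearMap.adjoint ∘ fun α => conj (monomial (q x) α) • D α := funext fun α => by
    rw [Function.comp_apply, map_smulₛₗ, Complex.conj_conj]
  rw [e]
  exact h'

end

/-! ### Admissibility of the polydisc kernel and its consequence for `S`. -/

section

open Classical in
/-- The Szegő kernel of a polydisc in `Ω`, extended by zero to `Ω`, times the projection onto the
line spanned by the unit vector `e`. -/
noncomputable def polydiscKernel {m : ℕ} (Ω : Set (Fin m → ℂ)) (c : Fin m → ℂ) (r : ℝ)
    {Y : Type*} [NormedAddCommGroup Y] [InnerProductSpace ℂ Y] (e : Y) (x y : Ω) : Y →L[ℂ] Y :=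
  if (∀ i, ‖x.1 i - c i‖ < r) ∧ ∀ i, ‖y.1 i - c i‖ < r then
    szegoKernel c r x y • (innerSL ℂ e).smulRight e
  else 0

variable {m : ℕ} {Ω : Set (Fin m → ℂ)} {c : Fin m → ℂ} {r : ℝ}
  {Y : Type*} [NormedAddCommGroup Y] [InnerProductSpace ℂ Y]

/-- The rank-one factor turns the vectors `v j` into scalars `⟨e, v j⟩`, which reduces the claim to
the scalar Hardy space inequality. -/
theorem isPositiveKernel_polydiscKernel (hr : 0 < r) {g : (Fin m → ℂ) → ℂ}
    (hd : ∀ z, (∀ i, ‖z i - c i‖ ≤ r) → DifferentiableAt ℂ g z)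
    (hb : ∀ z, (∀ i, ‖z i - c i‖ ≤ r) → ‖g z‖ ≤ 1) (e : Y) :
    IsPositiveKernel fun x y : Ω =>
      (1 - g x * conj (g y)) • polydiscKernel Ω c r e x y := by
  classical
  intro n z v
  let p : Fin n → Prop := fun j => ∀ i, ‖(z j).1 i - c i‖ < r
  -- Points outside the polydisc are moved to `c` and given coefficient zero, to match the extension
  -- by zero.
  have h := szegoKernel_contraction hr hd hb (fun j => if p j then (z j).1 else c)
    (fun j i => by
      by_cases hj : p j
      · simpa [hj] using hj i
      · simpa [hj] using hr)
    (fun j => if p j then inner ℂ e (v j) else 0)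
  refine h.trans_eq (Finset.sum_congr rfl fun j _ => Finset.sum_congr rfl fun k _ => ?_)
  by_cases hj : p j
  · by_cases hk : p k
    · have e1 : polydiscKernel Ω c r e (z j) (z k) =
        szegoKernel c r (z j) (z k) • (innerSL ℂ e).smulRight e := if_pos ⟨hj, hk⟩
      beta_reduce
      rw [e1]
      simp only [hj, hk, if_true, smul_apply, ContinuousLinearMap.smulRight_apply,
        innerSL_apply_apply, inner_smul_right, inner_conj_symm]
      ring
    · have e1 : polydiscKernel Ω c r e (z j) (z k) = 0 := if_neg fun h => hk h.2
      simp [e1, hk]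
  · have e1 : polydiscKernel Ω c r e (z j) (z k) = 0 := if_neg fun h => hj h.1
    simp [e1, hj]

variable [CompleteSpace Y]

/-- The Szegő kernel of a closed polydisc in `Ω` gives an admissible kernel for every family of
holomorphic functions that are bounded by one. -/
theorem isAdmissible_polydiscKernel (hΩ : IsOpen Ω) {Ψ : Set (Ω → ℂ)}
    (hb : ∀ ψ ∈ Ψ, ∀ x, ‖ψ x‖ ≤ 1) (hol : ∀ ψ ∈ Ψ, IsHolomorphic ψ) (hr : 0 < r)
    (hsub : Metric.closedBall c r ⊆ Ω) (e : Y) :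
    IsAdmissible Ψ (polydiscKernel Ω c r e) := by
  have hmem : ∀ z : Fin m → ℂ, (∀ i, ‖z i - c i‖ ≤ r) → z ∈ Ω := fun z hz =>
    hsub (mem_closedBall_iff_norm.2 ((pi_norm_le_iff_of_nonneg hr.le).2 hz))
  refine isAdmissible_of_isPositiveKernel ?_ fun ψ hψ => ?_
  -- The choice `g = 0` gives positivity of the kernel itself.
  · simpa using isPositiveKernel_polydiscKernel (Ω := Ω) (c := c) hr (g := fun _ => 0)
      (fun z _ => differentiableAt_const _) (fun z _ => by simp) e
  · obtain ⟨g, hg, hgψ⟩ := hol ψ hψ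
    have := isPositiveKernel_polydiscKernel (Ω := Ω) (c := c) hr (g := g)
      (fun z hz => hg.differentiableAt (hΩ.mem_nhds (hmem z hz)))
      (fun z hz => by rw [hgψ ⟨z, hmem z hz⟩]; exact hb ψ hψ _) e
    simpa only [hgψ] using this

/-- Elementary tensors with one fixed unit vector `e` in the second slot strip the tensor product
off the positivity condition and leave the scalar `⟨e, k(x, y) e⟩`. -/
theorem inner_opTensor_coe_tmul {E F : Type*} [NormedAddCommGroup E] [InnerProductSpace ℂ E]
    [NormedAddCommGroup F] [InnerProductSpace ℂ F] (A : E →L[ℂ] E) (B : F →L[ℂ] F)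
    (v w : E) (e f : F) :
    inner ℂ (((v ⊗ₜ[ℂ] e : E ⊗[ℂ] F) : HilbertTensor E F))
      (opTensor A B ((w ⊗ₜ[ℂ] f : E ⊗[ℂ] F) : HilbertTensor E F)) =
      inner ℂ v (A w) * inner ℂ e (B f) := by
  have : opTensor A B ((w ⊗ₜ[ℂ] f : E ⊗[ℂ] F) : HilbertTensor E F) =
      ((A w ⊗ₜ[ℂ] B f : E ⊗[ℂ] F) : HilbertTensor E F) := by
    rw [opTensor, ContinuousLinearMap.completion_apply_coe, TensorProduct.mapL_tmul]
  rw [this, UniformSpace.Completion.inner_coe, TensorProduct.inner_tmul]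

theorem monomial_mul (p q : Fin m → ℂ) (α : Fin m → ℕ) :
    monomial (fun i => p i * q i) α = monomial p α * monomial q α := by
  simp [monomial, mul_pow, Finset.prod_mul_distrib]

/-- A function with an admissible constant is, near each point, a power series with coefficients
that satisfy Cauchy's estimates. -/
theorem exists_hasSum_monomial_of_admissibleConstants (hΩ : IsOpen Ω) {Ψ : Set (Ω → ℂ)}
    (hb : ∀ ψ ∈ Ψ, ∀ x, ‖ψ x‖ ≤ 1) (hol : ∀ ψ ∈ Ψ, IsHolomorphic ψ) (hr : 0 < r)
    (hsub : Metric.closedBall c r ⊆ Ω)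
    {U : Type*} [NormedAddCommGroup U] [InnerProductSpace ℂ U] [CompleteSpace U]
    {S : Ω → U →L[ℂ] Y} {C : ℝ} (hC : C ∈ admissibleConstants Ψ S) :
    ∃ b : (Fin m → ℕ) → U →L[ℂ] Y, (∀ α, ‖b α‖ ≤ C) ∧
      ∀ x : Ω, (∀ i, ‖x.1 i - c i‖ < r) →
        HasSum (fun α => monomial (fun i => (x.1 i - c i) / r) α • b α) (S x) := by
  -- A zero space has no unit vector `e`; there `S = 0`.
  rcases subsingleton_or_nontrivial Y with hY | hY
  · refine ⟨0, fun α => by simpa using hC.1, fun x _ => ?_⟩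
    rw [Subsingleton.elim (S x) 0]
    simp
  obtain ⟨e, he⟩ := exists_norm_eq Y zero_le_one
  have hpos := hC.2 _ (isAdmissible_polydiscKernel hΩ hb hol hr hsub e)
  let P := {x : Ω // ∀ i, ‖x.1 i - c i‖ < r}
  obtain ⟨b, hbC, hbS⟩ := exists_hasSum_of_szego_positive
    (fun (x : P) i => (x.1.1 i - c i) / (r : ℂ))
    (fun x i => by
      rw [norm_div, Complex.norm_real, Real.norm_eq_abs, abs_of_pos hr, div_lt_one hr]
      exact x.2 i)
    (fun x y => szegoKernel c r x.1 y.1) (fun x y => hasSum_szegoKernel x.2 y.2)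
    (fun x => S x.1) hC.1 (fun s v => by
      refine (hpos.sum_nonneg (fun x : P => x.1) s
        fun x => ((v x ⊗ₜ[ℂ] e : Y ⊗[ℂ] Y) : HilbertTensor Y Y)).trans_eq ?_
      refine Finset.sum_congr rfl fun x _ => Finset.sum_congr rfl fun y _ => ?_
      rw [inner_opTensor_coe_tmul]
      have e1 : polydiscKernel Ω c r e x.1 y.1 =
        szegoKernel c r x.1 y.1 • (innerSL ℂ e).smulRight e := if_pos ⟨x.2, y.2⟩
      rw [e1]
      simp [he, inner_self_eq_norm_sq_to_K])
  exact ⟨b, hbC, fun x hx => hbS ⟨x, hx⟩⟩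

end

end SchurAgler

/-! ### The local power series of a Schur–Agler function. -/

theorem theorem3p4 {m : ℕ} (Ω : Set (Fin m → ℂ)) (hΩ : IsOpen Ω) (hΩc : IsConnected Ω)
    (Ψ : Set (Ω → ℂ)) (hΨ : SchurAgler.IsTestFamily Ψ)
    (hΨhol : ∀ ψ ∈ Ψ, SchurAgler.IsHolomorphic ψ)
    {U Y : Type*}
    [NormedAddCommGroup U] [InnerProductSpace ℂ U] [CompleteSpace U]
    [NormedAddCommGroup Y] [InnerProductSpace ℂ Y] [CompleteSpace Y]
    (z₀ : Ω) (S : Ω → U →L[ℂ] Y) (hS : S ∈ SchurAgler.schurAglerClass Ψ) :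
    ∃ ε : Fin m → ℝ, (∀ i, 0 < ε i) ∧
      IsCompact (closure (SchurAgler.polydisc (z₀ : Fin m → ℂ) ε)) ∧
      closure (SchurAgler.polydisc (z₀ : Fin m → ℂ) ε) ⊆ Ω ∧
      ∃ a : (Fin m → ℕ) → U →L[ℂ] Y,
        -- the power series converges absolutely to `S` at each point of the polydisc
        (∀ z : Ω, (z : Fin m → ℂ) ∈ SchurAgler.polydisc (z₀ : Fin m → ℂ) ε →
          Summable (fun α : Fin m → ℕ =>
            ‖SchurAgler.monomial ((z : Fin m → ℂ) - (z₀ : Fin m → ℂ)) α • a α‖) ∧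
          HasSum (fun α : Fin m → ℕ => SchurAgler.monomial ((z : Fin m → ℂ) - (z₀ : Fin m → ℂ)) α • a α)
            (S z)) ∧
        -- the finite partial sums converge to `S` uniformly on each compact subset
        (∀ L : Set Ω, IsCompact L →
          (∀ z ∈ L, (z : Fin m → ℂ) ∈ SchurAgler.polydisc (z₀ : Fin m → ℂ) ε) →
          TendstoUniformlyOn
            (fun (A : Finset (Fin m → ℕ)) (z : Ω) =>
              ∑ α ∈ A, SchurAgler.monomial ((z : Fin m → ℂ) - (z₀ : Fin m → ℂ)) α • a α)
            S Filter.atTop L) := by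
  obtain ⟨C, hC⟩ := hS.1
  -- The norm on `Fin m → ℂ` is the sup norm, so balls are polydiscs with equal radii.
  obtain ⟨r, hr, hsub⟩ := Metric.nhds_basis_closedBall.mem_iff.1 (hΩ.mem_nhds z₀.2)
  have hbd : ∀ ψ ∈ Ψ, ∀ x, ‖ψ x‖ ≤ 1 := fun ψ hψ x => by
    obtain ⟨ρ, hρ, h⟩ := hΨ.sup_lt_one x
    exact (h ψ hψ).trans hρ.le
  obtain ⟨b, hbC, hbS⟩ := SchurAgler.exists_hasSum_monomial_of_admissibleConstants hΩ hbd hΨhol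
    hr hsub hC
  have hr' : (r : ℂ) ≠ 0 := by exact_mod_cast hr.ne'
  have hclosure : closure (SchurAgler.polydisc (z₀ : Fin m → ℂ) fun _ => r) ⊆
      Metric.closedBall (z₀ : Fin m → ℂ) r := by
    refine closure_minimal (fun z hz => ?_) Metric.isClosed_closedBall
    exact mem_closedBall_iff_norm.2 ((pi_norm_le_iff_of_nonneg hr.le).2 fun i => (hz i).le)
  have hterm : ∀ (z : Fin m → ℂ) (α : Fin m → ℕ),
      SchurAgler.monomial (z - (z₀ : Fin m → ℂ)) α • SchurAgler.monomial (fun _ => (r : ℂ)⁻¹) α • b α =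
        SchurAgler.monomial (fun i => (z i - z₀.1 i) / (r : ℂ)) α • b α := fun z α => by
    simp only [div_eq_mul_inv]
    rw [SchurAgler.monomial_mul, mul_smul]
    rfl
  have hbound : ∀ (z : Fin m → ℂ) (α : Fin m → ℕ),
      ‖SchurAgler.monomial (fun i => (z i - z₀.1 i) / (r : ℂ)) α • b α‖ ≤
        ‖SchurAgler.monomial (fun i => (z i - z₀.1 i) / (r : ℂ)) α‖ * C := fun z α => by
    rw [norm_smul]
    exact mul_le_mul_of_nonneg_left (hbC α) (norm_nonneg _)
  refine ⟨fun _ => r, fun _ => hr,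
    (isCompact_closedBall _ _).of_isClosed_subset isClosed_closure hclosure,
    hclosure.trans hsub, fun α => SchurAgler.monomial (fun _ => (r : ℂ)⁻¹) α • b α, ?_, ?_⟩
  · intro z hz
    simp only [hterm]
    refine ⟨?_, hbS z hz⟩
    refine Summable.of_nonneg_of_le (fun _ => norm_nonneg _) (hbound z)
      ((SchurAgler.hasSum_monomial _ fun i => ?_).1.mul_right C)
    rw [norm_div, Complex.norm_real, Real.norm_eq_abs, abs_of_pos hr, div_lt_one hr]
    exact hz i
  · intro K hK hKP
    simp only [hterm]
    rcases K.eq_empty_or_nonempty with rfl | hne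
    · exact tendstoUniformlyOn_empty
    -- Compactness keeps `K` within a smaller radius `ρ < r`; the Weierstrass test applies with
    -- majorant `C (ρ / r) ^ |α|`.
    obtain ⟨w, hw, hmax⟩ := hK.exists_isMaxOn hne
      (f := fun z : Ω => ‖(z : Fin m → ℂ) - z₀‖) (by fun_prop)
    set ρ := ‖(w : Fin m → ℂ) - z₀‖
    have hρ : ρ < r := (pi_norm_lt_iff hr).2 fun i => hKP w hw i
    have hu := (SchurAgler.hasSum_monomial (fun _ : Fin m => ((ρ / r : ℝ) : ℂ)) fun i => by
      rw [Complex.norm_real, Real.norm_of_nonneg (by positivity), div_lt_one hr]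
      exact hρ).1.mul_right C
    refine (tendstoUniformlyOn_tsum (s := K) (f := fun α (z : Ω) =>
      SchurAgler.monomial (fun i => (z.1 i - z₀.1 i) / (r : ℂ)) α • b α) hu
      fun α z hz => ?_).congr_right fun z hz => (hbS z (hKP z hz)).tsum_eq
    refine (hbound z α).trans (mul_le_mul_of_nonneg_right ?_ hC.1)
    simp only [SchurAgler.monomial, norm_prod, norm_pow]
    refine Finset.prod_le_prod (fun i _ => by positivity) fun i _ => ?_
    refine pow_le_pow_left₀ (norm_nonneg _) ?_ _
    rw [norm_div, Complex.norm_real, Complex.norm_real, Real.norm_of_nonneg hr.le,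
      Real.norm_of_nonneg (by positivity)]
    exact div_le_div_of_nonneg_right
      ((norm_le_pi_norm ((z : Fin m → ℂ) - (z₀ : Fin m → ℂ)) i).trans (hmax hz)) hr.le
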